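/- A unimodal map is a $C^1$ map $f:[0,1]\to[0,1]$ with a unique critical point $c\in(0,1)$, strictly increasing on $[0,c]$ and strictly decreasing on $[c,1]$. It is $C^{1+Lip}$ if $f'$ is Lipschitz on $[0,1]$, and it has a quadratic tip if there are $l>0$ and points $y_n\neq c$ of $[0,1]$ with $y_n\to c$ and $\frac{f(y_n)-f(c)}{(y_n-c)^2}\to -l$. A unimodal map $f$ with $f(c)=1$ and $f(1)=0$ is period quintupling renormalizable if $f^3(0)<c<f^8(0)$, the interval $I_2=[f^3(0),f^8(0)]\subseteq[0,1]$ satisfies $f^5(I_2)\subseteq I_2$, and the sets $I_5=f(I_2)$, $I_1=f^2(I_2)$, $I_3=f^3(I_2)$, $I_4=f^4(I_2)$ are such that $I_1,I_2,I_3,I_4,I_5$ are pairwise disjoint and lie in this order from left to right. Its renormalization is $Rf=h^{-1}\circ f^5\circ h$, where $h:[0,1]\to I_2$ is the orientation reversing affine homeomorphism. The map $f$ is infinitely renormalizable (for period quintupling) if $R^nf$ is period quintupling renormalizable for every $n\ge 0$, and there are nested nondegenerate proper closed subintervals $J_0\supseteq J_1\supseteq\cdots$ of $[0,1]$ with lengths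 tending to $0$ such that, for every $n$, $f^{5^{n+1}}(J_n)\subseteq J_n$ and the sets $f^i(J_n)$, $0\le i<5^{n+1}$, have pairwise disjoint interiors. A Cantor set is a nonempty, compact, perfect, totally disconnected subset of $\mathbb{R}$. **Theorem** (dense Cantor set of critical points, period quintupling). There exists an infinitely renormalizable (for period quintupling) $C^{1+Lip}$ unimodal map $k$ with a quadratic tip such that, $c_n$ denoting the critical point of the unimodal map $R^nk$, the set $\{c_n\}_{n\ge0}$ is a dense subset of a Cantor set. -/

import Mathlib

open Set Filter Topology

/-!
Interval maps `[0,1] → [0,1]` are represented by functions `ℝ → ℝ` of which only the values on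
`[0,1]` matter; derivatives are one-sided at the end points (`derivWithin`).
-/

/-- `f` restricts to a unimodal map of `[0,1]` with critical point `c`: a `C¹` self-map of `[0,1]`
whose unique critical point is the interior turning point `c`. -/
structure IsUnimodal (f : ℝ → ℝ) (c : ℝ) : Prop where
  mapsTo : MapsTo f (Icc 0 1) (Icc 0 1)
  contDiffOn : ContDiffOn ℝ 1 f (Icc 0 1)
  mem_Ioo : c ∈ Ioo (0 : ℝ) 1
  critical_iff : ∀ x ∈ Icc (0 : ℝ) 1, derivWithin f (Icc 0 1) x = 0 ↔ x = c
  strictMonoOn : StrictMonoOn f (Icc 0 c)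
  strictAntiOn : StrictAntiOn f (Icc c 1)

/-- `f` is of class `C^{1+Lip}` on `[0,1]`: differentiable, with Lipschitz derivative. -/
def IsC1Lip (f : ℝ → ℝ) : Prop :=
  DifferentiableOn ℝ f (Icc 0 1) ∧
    ∃ L : NNReal, LipschitzOnWith L (derivWithin f (Icc 0 1)) (Icc 0 1)

/-- `f` has a quadratic tip at `c`. -/
def HasQuadraticTip (f : ℝ → ℝ) (c : ℝ) : Prop :=
  ∃ (y : ℕ → ℝ) (l : ℝ), (∀ n, y n ∈ Icc (0 : ℝ) 1 ∧ y n ≠ c) ∧ Tendsto y atTop (𝓝 c) ∧ 0 < l ∧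
    Tendsto (fun n => (f (y n) - f c) / (y n - c) ^ 2) atTop (𝓝 (-l))

/-- `f^m : [a,b] → [a,b]` is a renormalization of `f`: `[a,b]` is a proper nondegenerate
subinterval of `[0,1]`, the sets `f^i([a,b])`, `0 ≤ i < m`, have pairwise disjoint interiors and
`f^m([a,b]) ⊆ [a,b]`. -/
def IsRenormalization (f : ℝ → ℝ) (a b : ℝ) (m : ℕ) : Prop :=
  0 < m ∧ a < b ∧ Icc a b ⊂ Icc 0 1 ∧
    (∀ i < m, ∀ j < m, i ≠ j →
      Disjoint (interior (f^[i] '' Icc a b)) (interior (f^[j] '' Icc a b))) ∧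
    MapsTo f^[m] (Icc a b) (Icc a b)

/-- `f` is infinitely renormalizable with periods `m 0, m 1, …`: there is a nested sequence of
intervals `[a n, b n]`, with lengths tending to `0`, on which `f^{m n}` is a renormalization. -/
def IsInfinitelyRenormalizable (f : ℝ → ℝ) (m : ℕ → ℕ) : Prop :=
  ∃ a b : ℕ → ℝ, (∀ n, IsRenormalization f (a n) (b n) (m n)) ∧
    (∀ n, Icc (a (n + 1)) (b (n + 1)) ⊆ Icc (a n) (b n)) ∧
    Tendsto (fun n => b n - a n) atTop (𝓝 0)

/-- The interval `[f³(0), f⁸(0)]` on which the period quintupling renormalization takes place.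
For maps with `f(c) = 1` and `f(1) = 0` it is `[f⁵(c), f¹⁰(c)]`. -/
def quintInterval (f : ℝ → ℝ) : Set ℝ := Icc (f^[3] 0) (f^[8] 0)

/-- The orientation reversing affine bijection from `[0,1]` onto `quintInterval f`. -/
def quintScale (f : ℝ → ℝ) (x : ℝ) : ℝ := f^[3] 0 + (f^[8] 0 - f^[3] 0) * (1 - x)

/-- The inverse of `quintScale f`. -/
noncomputable def quintScaleInv (f : ℝ → ℝ) (x : ℝ) : ℝ :=
  1 - (x - f^[3] 0) / (f^[8] 0 - f^[3] 0)

/-- The maps `quintScale f` and `quintScaleInv f` are inverse to each other. -/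
theorem quintScaleInv_quintScale {f : ℝ → ℝ} (h : f^[3] 0 < f^[8] 0) (x : ℝ) :
    quintScaleInv f (quintScale f x) = x ∧ quintScale f (quintScaleInv f x) = x := by
  have h' : f^[8] 0 - f^[3] 0 ≠ 0 := sub_ne_zero.2 h.ne'
  unfold quintScaleInv quintScale
  constructor
  · field_simp
    ring
  · field_simp
    ring

/-- `f` is period quintupling renormalizable: it is unimodal with critical point `c`, normalized by
`f(c) = 1` and `f(1) = 0`, the interval `I₂ = quintInterval f` is a neighbourhood of `c`
inside `[0,1]` with `f⁵(I₂) ⊆ I₂`, and its images `I₅ = f(I₂)`, `I₁ = f²(I₂)`, `I₃ = f³(I₂)`,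
`I₄ = f⁴(I₂)` lie in `[0,1]` in the order `I₁ < I₂ < I₃ < I₄ < I₅`
(so they are pairwise disjoint and `I₂ → I₅ → I₁ → I₃ → I₄ → I₂`). -/
def IsQuintRenormalizable (f : ℝ → ℝ) : Prop :=
  ∃ c : ℝ, IsUnimodal f c ∧ f c = 1 ∧ f 1 = 0 ∧
    f^[3] 0 < c ∧ c < f^[8] 0 ∧
    quintInterval f ⊆ Icc 0 1 ∧
    MapsTo f^[5] (quintInterval f) (quintInterval f) ∧
    (∀ x ∈ f^[2] '' quintInterval f, ∀ y ∈ quintInterval f, x < y) ∧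
    (∀ x ∈ quintInterval f, ∀ y ∈ f^[3] '' quintInterval f, x < y) ∧
    (∀ x ∈ f^[3] '' quintInterval f, ∀ y ∈ f^[4] '' quintInterval f, x < y) ∧
    (∀ x ∈ f^[4] '' quintInterval f, ∀ y ∈ f '' quintInterval f, x < y)

/-- The period quintupling renormalization operator `R f = h⁻¹ ∘ f⁵ ∘ h`, where `h` is the
orientation reversing affine bijection from `[0,1]` onto `quintInterval f`. -/
noncomputable def quintRenorm (f : ℝ → ℝ) : ℝ → ℝ :=
  fun x => quintScaleInv f (f^[5] (quintScale f x))

/-- `f` is infinitely renormalizable for period quintupling: all the iterates `Rⁿ f` are period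
quintupling renormalizable, and `f` is infinitely renormalizable with periods `5, 25, 125, …`. -/
def IsInfinitelyQuintRenormalizable (f : ℝ → ℝ) : Prop :=
  (∀ n, IsQuintRenormalizable (quintRenorm^[n] f)) ∧
    IsInfinitelyRenormalizable f (fun n => 5 ^ (n + 1))

/-- A Cantor set on the line: nonempty, compact, perfect and totally disconnected. -/
def IsCantorSet (C : Set ℝ) : Prop :=
  C.Nonempty ∧ IsCompact C ∧ Perfect C ∧ IsTotallyDisconnected C

/-! The construction makes renormalization act as a shift. To each sequence `p` with entries in
`[29/50, 61/100]` is attached a unimodal map `tipMap p` with `f(0) = p 0`, `f(c) = 1`, `f(1) = 0`.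
It has slope `5/4` near `0` and slope `-2` on `[p 0, 1]`. On the interval `I₂` of length `1/10`
starting at `4 * p 0 - 2`, its graph is a copy of the graph of `tipMap (shiftSeq p)`, flipped
horizontally, shrunk by `10` horizontally and by `100` vertically, and attached at height `1`
(`tipMap_tipScale`). The four steps leading from `f(I₂)` back to `I₂` are affine with total
expansion `2 * (5/4) * 2 * 2 = 10` (`tip_orbit`). Hence `f⁵` on `I₂` is conjugate to `tipMap
(shiftSeq p)`, and `quintRenorm` realizes the shift (`quintRenorm_tip`).

The ratio `100 = 10²` preserves second differences. The slope is therefore rescaled by `-1/10` on an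
interval of length `1/10`, and one Lipschitz constant serves at all scales
(`slopeApprox_lipschitz`). The same ratio gives the quadratic tip (`hasQuadraticTip_tip`).

The turning point is `c(p) = ∑ (-1/10)^k (4 p_k - 2 + 1/10)`. Over the sequences with entries in
`{29/50, 61/100}` it is a continuous injective function of the binary code, so its image is a Cantor
set (`isCantorSet_range_codeCenter`). The critical points of the renormalizations are the values at
the shifts of the code. A code containing every finite word has a dense shift orbit
(`exists_universalCode_eq`), so these critical points are dense in the Cantor set. -/

/-- The shifted sequence. -/
def shiftSeq (p : ℕ → ℝ) : ℕ → ℝ := fun n => p (n + 1)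

/-- The sequences of parameters used for the construction. -/
def Admissible (p : ℕ → ℝ) : Prop := ∀ n, p n ∈ Icc (29 / 50 : ℝ) (61 / 100)

theorem Admissible.shift {p : ℕ → ℝ} (hp : Admissible p) : Admissible (shiftSeq p) :=
  fun n => hp (n + 1)

/-! ### Quadratic ramps with prescribed end values and mean. -/

/-- The retraction of the line onto `[0,1]`. -/
noncomputable def clamp (x : ℝ) : ℝ := max 0 (min 1 x)

theorem clamp_mem (x : ℝ) : clamp x ∈ Icc (0 : ℝ) 1 :=
  ⟨le_max_left _ _, max_le zero_le_one (min_le_left _ _)⟩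

theorem clamp_of_mem {x : ℝ} (hx : x ∈ Icc (0 : ℝ) 1) : clamp x = x := by
  rw [clamp, min_eq_right hx.2, max_eq_right hx.1]

theorem clamp_of_nonpos {x : ℝ} (hx : x ≤ 0) : clamp x = 0 := by
  rw [clamp, min_eq_right (hx.trans zero_le_one), max_eq_left hx]

theorem clamp_of_one_le {x : ℝ} (hx : 1 ≤ x) : clamp x = 1 := by
  rw [clamp, min_eq_left hx, max_eq_right zero_le_one]

theorem abs_clamp_sub_le (x y : ℝ) : |clamp x - clamp y| ≤ |x - y| := by
  have h1 := abs_max_sub_max_le_abs (min 1 x) (min 1 y) 0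
  have h2 := abs_min_sub_min_le_max 1 x 1 y
  rw [max_comm, max_comm (min 1 y)] at h1
  rw [sub_self, abs_zero, max_eq_right (abs_nonneg _)] at h2
  exact h1.trans h2

/-- The quadratic polynomial with values `d`, `e` at `0`, `1` and with mean `S` over `[0,1]`. -/
noncomputable def quadInterp (d e S t : ℝ) : ℝ :=
  d + (e - d) * t + 6 * (S - (d + e) / 2) * (t * (1 - t))

theorem quadInterp_zero (d e S : ℝ) : quadInterp d e S 0 = d := by simp [quadInterp]

theorem quadInterp_one (d e S : ℝ) : quadInterp d e S 1 = e := by simp [quadInterp]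

theorem abs_quadInterp_sub_le (d e S : ℝ) {s t : ℝ} (hs : s ∈ Icc (0 : ℝ) 1)
    (ht : t ∈ Icc (0 : ℝ) 1) :
    |quadInterp d e S s - quadInterp d e S t| ≤
      (|e - d| + 6 * |S - (d + e) / 2|) * |s - t| := by
  have h : quadInterp d e S s - quadInterp d e S t =
      (e - d + 6 * (S - (d + e) / 2) * (1 - s - t)) * (s - t) := by
    unfold quadInterp; ring
  rw [h, abs_mul]
  refine mul_le_mul_of_nonneg_right ((abs_add_le _ _).trans ?_) (abs_nonneg _)
  have h1 : |1 - s - t| ≤ 1 := abs_le.2 ⟨by linarith [hs.2, ht.2], by linarith [hs.1, ht.1]⟩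
  rw [abs_mul, abs_mul, abs_of_pos (show (0 : ℝ) < 6 by norm_num)]
  nlinarith [abs_nonneg (S - (d + e) / 2)]

/-- The function that is `d` to the left of `x`, `e` to the right of `y`, and interpolates
quadratically on `[x, y]` with mean `S`. -/
noncomputable def ramp (d e S x y z : ℝ) : ℝ := quadInterp d e S (clamp ((z - x) / (y - x)))

theorem ramp_of_le {d e S x y z : ℝ} (hxy : x < y) (hz : z ≤ x) : ramp d e S x y z = d := by
  rw [ramp, clamp_of_nonpos (div_nonpos_of_nonpos_of_nonneg (by linarith) (by linarith)),
    quadInterp_zero]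

theorem ramp_of_ge {d e S x y z : ℝ} (hxy : x < y) (hz : y ≤ z) : ramp d e S x y z = e := by
  rw [ramp, clamp_of_one_le ((one_le_div (by linarith)).2 (by linarith)), quadInterp_one]

theorem abs_ramp_sub_le {d e S x y K : ℝ} (hxy : x < y)
    (hK : |e - d| + 6 * |S - (d + e) / 2| ≤ K * (y - x)) (z w : ℝ) :
    |ramp d e S x y z - ramp d e S x y w| ≤ K * |z - w| := by
  have hpos : 0 < y - x := by linarith
  refine (abs_quadInterp_sub_le d e S (clamp_mem _) (clamp_mem _)).trans ?_
  calc _ ≤ K * (y - x) * |(z - x) / (y - x) - (w - x) / (y - x)| :=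
        mul_le_mul hK (abs_clamp_sub_le _ _) (abs_nonneg _) (le_trans (by positivity) hK)
    _ = K * |z - w| := by
        rw [← sub_div, abs_div, abs_of_pos hpos, sub_sub_sub_cancel_right]
        field_simp

/-- Linear interpolation has mean `(d + e) / 2`, and `6t(1 - t)` has integral `1` over `[0,1]`, so
the correction term moves the mean to `S`. The proof compares `F` with an explicit cubic
antiderivative. -/
theorem sub_eq_of_hasDerivAt_ramp {F : ℝ → ℝ} {d e S x y : ℝ} (hxy : x < y)
    (hF : ∀ z ∈ Icc x y, HasDerivAt F (ramp d e S x y z) z) : F y - F x = S * (y - x) := by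
  have hpos : y - x ≠ 0 := by linarith
  set P : ℝ → ℝ := fun z => (d * ((z - x) / (y - x)) + (e - d) / 2 * ((z - x) / (y - x)) ^ 2 +
    (S - (d + e) / 2) * (3 * ((z - x) / (y - x)) ^ 2 - 2 * ((z - x) / (y - x)) ^ 3)) * (y - x)
    with hP
  have hPd : ∀ z ∈ Icc x y, HasDerivAt P (ramp d e S x y z) z := by
    intro z hz
    have hz' : (z - x) / (y - x) ∈ Icc (0 : ℝ) 1 :=
      ⟨div_nonneg (by linarith [hz.1]) (by linarith),
        (div_le_one (by linarith)).2 (by linarith [hz.2])⟩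
    have h0 : HasDerivAt (fun z : ℝ => (z - x) / (y - x)) (1 / (y - x)) z :=
      ((hasDerivAt_id z).sub_const x).div_const _
    have h1 := (((h0.const_mul d).add ((h0.pow 2).const_mul ((e - d) / 2))).add
      ((((h0.pow 2).const_mul 3).sub ((h0.pow 3).const_mul 2)).const_mul
        (S - (d + e) / 2))).mul_const (y - x)
    refine h1.congr_deriv ?_
    rw [ramp, clamp_of_mem hz', quadInterp]
    push_cast
    field_simp
    ring
  have hconst : ∀ z ∈ Icc x y, F z - P z = F x - P x := by
    refine constant_of_has_deriv_right_zero ?_ ?_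
    · exact fun z hz => ((hF z hz).sub (hPd z hz)).continuousAt.continuousWithinAt
    · intro z hz
      have h := (hF z (Ico_subset_Icc_self hz)).sub (hPd z (Ico_subset_Icc_self hz))
      rw [sub_self] at h
      exact h.hasDerivWithinAt
  have h1 := hconst y (right_mem_Icc.2 hxy.le)
  have h2 : P x = 0 := by simp [hP]
  have h3 : P y = S * (y - x) := by
    simp only [hP]
    rw [div_self hpos]
    ring
  linarith

/-! ### Slopes outside the renormalization interval. -/

/-- The slope to the left of the renormalization interval. -/
noncomputable def leftSlope (u : ℝ) : ℝ → ℝ :=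
  ramp (5 / 4) (1 / 5) ((193 / 200 - u) / (4 * u - 2 - 1 / 50)) (1 / 50) (4 * u - 2)

/-- The slope to the right of the renormalization interval. -/
noncomputable def rightSlope (u v : ℝ) : ℝ → ℝ :=
  ramp (-1 / 8) (-2) ((1 - 2 * u + (1 - v) / 100) / (u - (4 * u - 2 + 1 / 10)))
    (4 * u - 2 + 1 / 10) u

theorem leftMean_mem {u : ℝ} (hu : u ∈ Icc (29 / 50 : ℝ) (61 / 100)) :
    (193 / 200 - u) / (4 * u - 2 - 1 / 50) ∈ Icc (4 / 5 : ℝ) (13 / 10) := by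
  have h : 0 < 4 * u - 2 - 1 / 50 := by linarith [hu.1]
  exact ⟨(le_div_iff₀ h).2 (by linarith [hu.2]), (div_le_iff₀ h).2 (by linarith [hu.1])⟩

theorem rightMean_mem {u v : ℝ} (hu : u ∈ Icc (29 / 50 : ℝ) (61 / 100))
    (hv : v ∈ Icc (29 / 50 : ℝ) (61 / 100)) :
    (1 - 2 * u + (1 - v) / 100) / (u - (4 * u - 2 + 1 / 10)) ∈ Icc (-4 : ℝ) (-24 / 25) := by
  have h : 0 < u - (4 * u - 2 + 1 / 10) := by linarith [hu.2]
  exact ⟨(le_div_iff₀ h).2 (by linarith [hu.2, hv.2]),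
    (div_le_iff₀ h).2 (by linarith [hu.1, hv.1])⟩

theorem leftSlope_bounds {u : ℝ} (hu : u ∈ Icc (29 / 50 : ℝ) (61 / 100)) (x : ℝ) :
    leftSlope u x ∈ Icc (1 / 8 : ℝ) 6 := by
  have hS := leftMean_mem hu
  have ht := clamp_mem ((x - 1 / 50) / (4 * u - 2 - 1 / 50))
  rw [leftSlope, ramp, quadInterp]
  generalize (193 / 200 - u) / (4 * u - 2 - 1 / 50) = S at *
  generalize clamp ((x - 1 / 50) / (4 * u - 2 - 1 / 50)) = t at *
  obtain ⟨h1, h2⟩ := hS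
  obtain ⟨h3, h4⟩ := ht
  have h5 : 0 ≤ t * (1 - t) := mul_nonneg h3 (by linarith)
  have h6 : t * (1 - t) ≤ 1 := by nlinarith
  constructor <;> nlinarith

theorem rightSlope_bounds {u v : ℝ} (hu : u ∈ Icc (29 / 50 : ℝ) (61 / 100))
    (hv : v ∈ Icc (29 / 50 : ℝ) (61 / 100)) (x : ℝ) :
    rightSlope u v x ∈ Icc (-20 : ℝ) (-1 / 8) := by
  have hS := rightMean_mem hu hv
  have ht := clamp_mem ((x - (4 * u - 2 + 1 / 10)) / (u - (4 * u - 2 + 1 / 10)))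
  rw [rightSlope, ramp, quadInterp]
  generalize (1 - 2 * u + (1 - v) / 100) / (u - (4 * u - 2 + 1 / 10)) = S at *
  generalize clamp ((x - (4 * u - 2 + 1 / 10)) / (u - (4 * u - 2 + 1 / 10))) = t at *
  obtain ⟨h1, h2⟩ := hS
  obtain ⟨h3, h4⟩ := ht
  have h5 : 0 ≤ t * (1 - t) := mul_nonneg h3 (by linarith)
  have h6 : t * (1 - t) ≤ 1 := by nlinarith
  -- The mean may exceed the average of the end values, so the quadratic correction can be positive.
  -- It is then at most a small multiple of `t`, which the linear drop from `-1/8` to `-2`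
  -- outweighs.
  have h7 : t * (1 - t) ≤ t := by nlinarith
  constructor <;> nlinarith

theorem abs_leftSlope_sub_le {u : ℝ} (hu : u ∈ Icc (29 / 50 : ℝ) (61 / 100)) (x y : ℝ) :
    |leftSlope u x - leftSlope u y| ≤ 300 * |x - y| := by
  have hS := leftMean_mem hu
  refine abs_ramp_sub_le (by linarith [hu.1]) ?_ x y
  have h1 : |(193 / 200 - u) / (4 * u - 2 - 1 / 50) - (5 / 4 + 1 / 5) / 2| ≤ 1 :=
    abs_le.2 ⟨by linarith [hS.1], by linarith [hS.2]⟩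
  have h2 : |(1 / 5 - 5 / 4 : ℝ)| ≤ 2 := by norm_num [abs_le]
  linarith [hu.1]

/-- This ramp determines the constant `300`: its variation bound is `20`, while for `u = 61/100` it
has length only `7/100`. -/
theorem abs_rightSlope_sub_le {u v : ℝ} (hu : u ∈ Icc (29 / 50 : ℝ) (61 / 100))
    (hv : v ∈ Icc (29 / 50 : ℝ) (61 / 100)) (x y : ℝ) :
    |rightSlope u v x - rightSlope u v y| ≤ 300 * |x - y| := by
  have hS := rightMean_mem hu hv
  refine abs_ramp_sub_le (by linarith [hu.2]) ?_ x y
  have h1 : |(1 - 2 * u + (1 - v) / 100) / (u - (4 * u - 2 + 1 / 10)) - (-1 / 8 + -2) / 2| ≤ 3 :=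
    abs_le.2 ⟨by linarith [hS.1], by linarith [hS.2]⟩
  have h2 : |(-2 - -1 / 8 : ℝ)| ≤ 2 := by norm_num [abs_le]
  linarith [hu.2]

/-! ### The self-similar slope as a limit of approximations. -/

/-- The affine scaling of `[0,1]` onto the renormalization interval. -/
noncomputable def tipScale (u y : ℝ) : ℝ := 4 * u - 2 + (1 - y) / 10

/-- One step of the self-similar construction of the slopes. -/
noncomputable def slopeStep (G : (ℕ → ℝ) → ℝ → ℝ) (p : ℕ → ℝ) (x : ℝ) : ℝ :=
  if x ≤ 4 * p 0 - 2 then leftSlope (p 0) x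
  else if x ≤ 4 * p 0 - 2 + 1 / 10 then
    -(1 / 10) * G (shiftSeq p) (10 * (4 * p 0 - 2 + 1 / 10 - x))
  else rightSlope (p 0) (p 1) x

/-- The approximations of the slopes. -/
noncomputable def slopeApprox : ℕ → (ℕ → ℝ) → ℝ → ℝ
  | 0 => fun _ x => 5 / 4 - 13 / 4 * clamp x
  | n + 1 => slopeStep (slopeApprox n)

/-- The slope of the map with parameters `p`. -/
noncomputable def tipSlope (p : ℕ → ℝ) (x : ℝ) : ℝ := limUnder atTop fun n => slopeApprox n p x

theorem slopeApprox_bound (n : ℕ) {p : ℕ → ℝ} (hp : Admissible p) (x : ℝ) :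
    |slopeApprox n p x| ≤ 20 := by
  induction n generalizing p x with
  | zero =>
    have h := clamp_mem x
    exact abs_le.2 ⟨by simp only [slopeApprox]; linarith [h.2],
      by simp only [slopeApprox]; linarith [h.1]⟩
  | succ n ih =>
    simp only [slopeApprox, slopeStep]
    split_ifs
    · have h := leftSlope_bounds (hp 0) x
      exact abs_le.2 ⟨by linarith [h.1], by linarith [h.2]⟩
    · rw [abs_mul, abs_neg, abs_of_pos (show (0 : ℝ) < 1 / 10 by norm_num)]
      linarith [ih hp.shift (10 * (4 * p 0 - 2 + 1 / 10 - x))]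
    · have h := rightSlope_bounds (hp 0) (hp 1) x
      exact abs_le.2 ⟨by linarith [h.1], by linarith [h.2]⟩

theorem slopeApprox_succ_sub (n : ℕ) {p : ℕ → ℝ} (hp : Admissible p) (x : ℝ) :
    |slopeApprox (n + 1) p x - slopeApprox n p x| ≤ 40 * (1 / 10) ^ n := by
  induction n generalizing p x with
  | zero =>
    have h1 := abs_le.1 (slopeApprox_bound 1 hp x)
    have h2 := abs_le.1 (slopeApprox_bound 0 hp x)
    exact abs_le.2 ⟨by linarith [h1.1, h2.2], by linarith [h1.2, h2.1]⟩
  | succ n ih =>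
    change |slopeStep (slopeApprox (n + 1)) p x - slopeStep (slopeApprox n) p x| ≤ _
    simp only [slopeStep]
    split_ifs
    · rw [sub_self, abs_zero]; positivity
    · rw [← mul_sub, abs_mul, abs_neg, abs_of_pos (show (0 : ℝ) < 1 / 10 by norm_num), pow_succ]
      linarith [ih hp.shift (10 * (4 * p 0 - 2 + 1 / 10 - x))]
    · rw [sub_self, abs_zero]; positivity

theorem slopeApprox_tendsto {p : ℕ → ℝ} (hp : Admissible p) (x : ℝ) :
    Tendsto (fun n => slopeApprox n p x) atTop (𝓝 (tipSlope p x)) := by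
  refine (cauchySeq_of_le_geometric (1 / 10) 40 (by norm_num) fun n => ?_).tendsto_limUnder
  rw [dist_comm, Real.dist_eq]
  exact slopeApprox_succ_sub n hp x

theorem tipSlope_eq {p : ℕ → ℝ} (hp : Admissible p) (x : ℝ) : tipSlope p x = slopeStep tipSlope p x := by
  refine tendsto_nhds_unique ((tendsto_add_atTop_iff_nat 1).2 (slopeApprox_tendsto hp x)) ?_
  simp only [slopeApprox, slopeStep]
  split_ifs
  · exact tendsto_const_nhds
  · exact (slopeApprox_tendsto hp.shift _).const_mul _
  · exact tendsto_const_nhds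

theorem tipSlope_bound {p : ℕ → ℝ} (hp : Admissible p) (x : ℝ) : |tipSlope p x| ≤ 20 :=
  le_of_tendsto (slopeApprox_tendsto hp x).abs
    (Eventually.of_forall fun n => slopeApprox_bound n hp x)

theorem lipschitz_glue {f : ℝ → ℝ} {K a : ℝ} (h₁ : ∀ x y, x ≤ y → y ≤ a → |f x - f y| ≤ K * (y - x))
    (h₂ : ∀ x y, a ≤ x → x ≤ y → |f x - f y| ≤ K * (y - x)) (x y : ℝ) (hxy : x ≤ y) :
    |f x - f y| ≤ K * (y - x) := by
  rcases le_total y a with h | h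
  · exact h₁ x y hxy h
  rcases le_total a x with h' | h'
  · exact h₂ x y h' hxy
  have := abs_sub_le (f x) (f a) (f y)
  linarith [h₁ x a h' le_rfl, h₂ a y le_rfl h]

theorem leftSlope_zero {u : ℝ} (hu : u ∈ Icc (29 / 50 : ℝ) (61 / 100)) {x : ℝ}
    (hx : x ≤ 1 / 50) : leftSlope u x = 5 / 4 := ramp_of_le (by linarith [hu.1]) hx

theorem leftSlope_end {u : ℝ} (hu : u ∈ Icc (29 / 50 : ℝ) (61 / 100)) :
    leftSlope u (4 * u - 2) = 1 / 5 := ramp_of_ge (by linarith [hu.1]) le_rfl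

theorem rightSlope_start {u v : ℝ} (hu : u ∈ Icc (29 / 50 : ℝ) (61 / 100)) :
    rightSlope u v (4 * u - 2 + 1 / 10) = -1 / 8 := ramp_of_le (by linarith [hu.2]) le_rfl

theorem rightSlope_end {u v : ℝ} (hu : u ∈ Icc (29 / 50 : ℝ) (61 / 100)) {x : ℝ} (hx : u ≤ x) :
    rightSlope u v x = -2 := ramp_of_ge (by linarith [hu.2]) hx

theorem slopeApprox_zero (n : ℕ) {p : ℕ → ℝ} (hp : Admissible p) :
    slopeApprox n p 0 = 5 / 4 := by
  cases n with
  | zero => simp [slopeApprox, clamp]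
  | succ n =>
    rw [slopeApprox, slopeStep, if_pos (by linarith [(hp 0).1]), leftSlope_zero (hp 0) (by norm_num)]

theorem slopeApprox_one (n : ℕ) {p : ℕ → ℝ} (hp : Admissible p) :
    slopeApprox n p 1 = -2 := by
  cases n with
  | zero => simp [slopeApprox, clamp]; norm_num
  | succ n =>
    rw [slopeApprox, slopeStep, if_neg (by linarith [(hp 0).2]), if_neg (by linarith [(hp 0).2]),
      rightSlope_end (hp 0) (by linarith [(hp 0).2])]

theorem slopeStep_left {G : (ℕ → ℝ) → ℝ → ℝ} {p : ℕ → ℝ} {x : ℝ} (hx : x ≤ 4 * p 0 - 2) :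
    slopeStep G p x = leftSlope (p 0) x := by rw [slopeStep, if_pos hx]

/-- At the left end point the first branch of the definition applies. The formulas agree there
because the ramp ends at `1/5 = -(1/10) * (-2)`; at the other junction, likewise, `-1/8 = -(1/10) *
(5/4)`. -/
theorem slopeStep_mid {G : (ℕ → ℝ) → ℝ → ℝ} {p : ℕ → ℝ} (hp : Admissible p)
    (h1 : G (shiftSeq p) 1 = -2) {x : ℝ} (hx : 4 * p 0 - 2 ≤ x) (hx' : x ≤ 4 * p 0 - 2 + 1 / 10) :
    slopeStep G p x = -(1 / 10) * G (shiftSeq p) (10 * (4 * p 0 - 2 + 1 / 10 - x)) := by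
  rcases hx.eq_or_lt with h | h
  · rw [slopeStep, if_pos h.ge, ← h, leftSlope_end (hp 0)]
    rw [show 10 * (4 * p 0 - 2 + 1 / 10 - (4 * p 0 - 2)) = 1 by ring, h1]
    norm_num
  · rw [slopeStep, if_neg h.not_ge, if_pos hx']

theorem slopeStep_right {G : (ℕ → ℝ) → ℝ → ℝ} {p : ℕ → ℝ} (hp : Admissible p)
    (h0 : G (shiftSeq p) 0 = 5 / 4) {x : ℝ} (hx : 4 * p 0 - 2 + 1 / 10 ≤ x) :
    slopeStep G p x = rightSlope (p 0) (p 1) x := by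
  rcases hx.eq_or_lt with h | h
  · rw [slopeStep, if_neg (by linarith), if_pos h.ge, ← h, rightSlope_start (hp 0), sub_self,
      mul_zero, h0]
    norm_num
  · rw [slopeStep, if_neg (by linarith), if_neg h.not_ge]

/-- The rescaled copy divides both values and lengths by `10`, so its Lipschitz constant does not
change from one level to the next. -/
theorem slopeApprox_lipschitz (n : ℕ) {p : ℕ → ℝ} (hp : Admissible p) (x y : ℝ) (hxy : x ≤ y) :
    |slopeApprox n p x - slopeApprox n p y| ≤ 300 * (y - x) := by
  induction n generalizing p x y with
  | zero =>
    have h : slopeApprox 0 p x - slopeApprox 0 p y = 13 / 4 * (clamp y - clamp x) := by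
      simp only [slopeApprox]; ring
    have h2 := abs_clamp_sub_le y x
    rw [abs_of_nonneg (sub_nonneg.2 hxy)] at h2
    rw [h, abs_mul, abs_of_pos (show (0 : ℝ) < 13 / 4 by norm_num)]
    linarith
  | succ n ih =>
    rw [slopeApprox]
    refine lipschitz_glue (a := 4 * p 0 - 2) ?_ ?_ x y hxy
    · intro x y hxy hy
      rw [slopeStep_left hy, slopeStep_left (hxy.trans hy)]
      have := abs_leftSlope_sub_le (hp 0) x y
      rwa [abs_sub_comm x, abs_of_nonneg (sub_nonneg.2 hxy)] at this
    intro x y hx hxy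
    -- `lipschitz_glue` needs estimates on whole half-lines. Freezing the function to the left of `4
    -- * p 0 - 2` provides them for the two remaining pieces.
    have hcl : ∀ z, 4 * p 0 - 2 ≤ z → slopeStep (slopeApprox n) p z =
        slopeStep (slopeApprox n) p (max (4 * p 0 - 2) z) := fun z hz => by rw [max_eq_right hz]
    have key := lipschitz_glue (a := 4 * p 0 - 2 + 1 / 10) (K := 300)
      (f := fun z => slopeStep (slopeApprox n) p (max (4 * p 0 - 2) z)) ?_ ?_ x y hxy
    · rwa [hcl x hx, hcl y (hx.trans hxy)]
    · intro x y hxy hy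
      rw [slopeStep_mid hp (slopeApprox_one n hp.shift) (le_max_left _ _)
        (max_le (by linarith) (hxy.trans hy)),
        slopeStep_mid hp (slopeApprox_one n hp.shift) (le_max_left _ _) (max_le (by linarith) hy),
        ← mul_sub, abs_mul, abs_neg, abs_of_pos (show (0 : ℝ) < 1 / 10 by norm_num), abs_sub_comm]
      have hm : max (4 * p 0 - 2) x ≤ max (4 * p 0 - 2) y := max_le_max le_rfl hxy
      have hm' : max (4 * p 0 - 2) y - max (4 * p 0 - 2) x ≤ y - x := by
        rcases le_total (4 * p 0 - 2) x with h | h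
        · rw [max_eq_right h, max_eq_right (h.trans hxy)]
        · rw [max_eq_left h]
          rcases le_total (4 * p 0 - 2) y with h' | h'
          · rw [max_eq_right h']; linarith
          · rw [max_eq_left h']; linarith
      have := ih hp.shift (10 * (4 * p 0 - 2 + 1 / 10 - max (4 * p 0 - 2) y))
        (10 * (4 * p 0 - 2 + 1 / 10 - max (4 * p 0 - 2) x)) (by linarith)
      linarith
    · intro x y hx hxy
      rw [max_eq_right (by linarith), max_eq_right (by linarith),
        slopeStep_right hp (slopeApprox_zero n hp.shift) hx,
        slopeStep_right hp (slopeApprox_zero n hp.shift) (hx.trans hxy)]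
      have := abs_rightSlope_sub_le (hp 0) (hp 1) x y
      rwa [abs_sub_comm x, abs_of_nonneg (sub_nonneg.2 hxy)] at this

theorem tipSlope_lipschitz {p : ℕ → ℝ} (hp : Admissible p) : LipschitzWith 300 (tipSlope p) := by
  have key : ∀ x y, x ≤ y → |tipSlope p x - tipSlope p y| ≤ 300 * (y - x) := fun x y hxy =>
    le_of_tendsto ((slopeApprox_tendsto hp x).sub (slopeApprox_tendsto hp y)).abs
      (Eventually.of_forall fun n => slopeApprox_lipschitz n hp x y hxy)
  refine LipschitzWith.of_dist_le_mul fun x y => ?_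
  rw [Real.dist_eq, Real.dist_eq, NNReal.coe_ofNat]
  rcases le_total x y with h | h
  · rw [abs_sub_comm x, abs_of_nonneg (sub_nonneg.2 h)]; exact key x y h
  · rw [abs_sub_comm, abs_of_nonneg (sub_nonneg.2 h)]; exact key y x h

theorem tipSlope_zero {p : ℕ → ℝ} (hp : Admissible p) : tipSlope p 0 = 5 / 4 :=
  tendsto_nhds_unique (slopeApprox_tendsto hp 0)
    (tendsto_const_nhds.congr fun n => (slopeApprox_zero n hp).symm)

theorem tipSlope_one {p : ℕ → ℝ} (hp : Admissible p) : tipSlope p 1 = -2 :=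
  tendsto_nhds_unique (slopeApprox_tendsto hp 1)
    (tendsto_const_nhds.congr fun n => (slopeApprox_one n hp).symm)

theorem tipSlope_left {p : ℕ → ℝ} (hp : Admissible p) {x : ℝ} (hx : x ≤ 4 * p 0 - 2) :
    tipSlope p x = leftSlope (p 0) x := by rw [tipSlope_eq hp, slopeStep_left hx]

theorem tipSlope_right {p : ℕ → ℝ} (hp : Admissible p) {x : ℝ} (hx : 4 * p 0 - 2 + 1 / 10 ≤ x) :
    tipSlope p x = rightSlope (p 0) (p 1) x := by
  rw [tipSlope_eq hp, slopeStep_right hp (tipSlope_zero hp.shift) hx]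

theorem tipSlope_tipScale {p : ℕ → ℝ} (hp : Admissible p) {y : ℝ} (hy : y ∈ Icc (0 : ℝ) 1) :
    tipSlope p (tipScale (p 0) y) = -(1 / 10) * tipSlope (shiftSeq p) y := by
  have h1 := hy.1
  have h2 := hy.2
  rw [tipSlope_eq hp, slopeStep_mid hp (tipSlope_one hp.shift) (by rw [tipScale]; linarith)
    (by rw [tipScale]; linarith), tipScale]
  congr 2
  ring

/-! ### The turning point and the sign of the slope. -/

theorem summable_tipCenter {p : ℕ → ℝ} (hp : Admissible p) :
    Summable fun k => (-(1 / 10) : ℝ) ^ k * (4 * p k - 2 + 1 / 10) := by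
  refine Summable.of_norm_bounded (g := fun k => (1 / 10 : ℝ) ^ k)
    (summable_geometric_of_lt_one (by norm_num) (by norm_num)) fun k => ?_
  rw [norm_mul, norm_pow, norm_neg, Real.norm_of_nonneg (show (0 : ℝ) ≤ 1 / 10 by norm_num),
    Real.norm_of_nonneg (by linarith [(hp k).1])]
  exact mul_le_of_le_one_right (by positivity) (by linarith [(hp k).2])

/-- The turning point of the map with parameters `p`. -/
noncomputable def tipCenter (p : ℕ → ℝ) : ℝ :=
  ∑' k, (-(1 / 10) : ℝ) ^ k * (4 * p k - 2 + 1 / 10)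

theorem tipCenter_eq {p : ℕ → ℝ} (hp : Admissible p) :
    tipCenter p = tipScale (p 0) (tipCenter (shiftSeq p)) := by
  rw [tipCenter, (summable_tipCenter hp).tsum_eq_zero_add, tipScale, tipCenter, pow_zero, one_mul]
  have : ∀ k, (-(1 / 10) : ℝ) ^ (k + 1) * (4 * p (k + 1) - 2 + 1 / 10) =
      -(1 / 10) * ((-(1 / 10) : ℝ) ^ k * (4 * shiftSeq p k - 2 + 1 / 10)) := fun k => by
    rw [shiftSeq, pow_succ]; ring
  simp only [this]
  rw [tsum_mul_left]
  ring

theorem abs_tipCenter_le {p : ℕ → ℝ} (hp : Admissible p) : |tipCenter p| ≤ 10 / 9 := by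
  have h : HasSum (fun k => (1 / 10 : ℝ) ^ k) (10 / 9) := by
    have := hasSum_geometric_of_lt_one (r := (1 / 10 : ℝ)) (by norm_num) (by norm_num)
    norm_num at this ⊢
    exact this
  rw [← Real.norm_eq_abs, tipCenter]
  refine tsum_of_norm_bounded h fun k => ?_
  rw [norm_mul, norm_pow, norm_neg, Real.norm_of_nonneg (show (0 : ℝ) ≤ 1 / 10 by norm_num),
    Real.norm_of_nonneg (by linarith [(hp k).1])]
  exact mul_le_of_le_one_right (by positivity) (by linarith [(hp k).2])

theorem tipCenter_mem_Ioo {p : ℕ → ℝ} (hp : Admissible p) : tipCenter p ∈ Ioo (0 : ℝ) 1 := by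
  have h := abs_le.1 (abs_tipCenter_le hp.shift)
  rw [tipCenter_eq hp, tipScale]
  exact ⟨by linarith [(hp 0).1], by linarith [(hp 0).2]⟩

theorem tipScale_mem {u y : ℝ} (hy : y ∈ Icc (0 : ℝ) 1) :
    tipScale u y ∈ Icc (4 * u - 2) (4 * u - 2 + 1 / 10) :=
  ⟨by rw [tipScale]; linarith [hy.2], by rw [tipScale]; linarith [hy.1]⟩

theorem exists_tipScale_eq {u x : ℝ} (hx : x ∈ Icc (4 * u - 2) (4 * u - 2 + 1 / 10)) :
    ∃ y ∈ Icc (0 : ℝ) 1, tipScale u y = x :=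
  ⟨10 * (4 * u - 2 + 1 / 10 - x), ⟨by linarith [hx.2], by linarith [hx.1]⟩, by
    rw [tipScale]; ring⟩

theorem tipCenter_mem {p : ℕ → ℝ} (hp : Admissible p) :
    tipCenter p ∈ Ioo (4 * p 0 - 2) (4 * p 0 - 2 + 1 / 10) := by
  have h := tipCenter_mem_Ioo hp.shift
  rw [tipCenter_eq hp, tipScale]
  exact ⟨by linarith [h.2], by linarith [h.1]⟩

/-- The turning point lies in the rescaled copy at every level; each level gains a factor `1/10` on
the uniform bound `20`. -/
theorem tipSlope_tipCenter {p : ℕ → ℝ} (hp : Admissible p) : tipSlope p (tipCenter p) = 0 := by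
  have key : ∀ n : ℕ, ∀ p : ℕ → ℝ, Admissible p →
      |tipSlope p (tipCenter p)| ≤ 20 * (1 / 10 : ℝ) ^ n := by
    intro n
    induction n with
    | zero => intro p hp; simpa using tipSlope_bound hp _
    | succ n ih =>
      intro p hp
      rw [tipCenter_eq hp, tipSlope_tipScale hp (Ioo_subset_Icc_self (tipCenter_mem_Ioo hp.shift)),
        abs_mul, abs_neg, abs_of_pos (show (0 : ℝ) < 1 / 10 by norm_num), pow_succ]
      linarith [ih _ hp.shift]
  have hlim : Tendsto (fun n : ℕ => 20 * (1 / 10 : ℝ) ^ n) atTop (𝓝 (20 * 0)) :=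
    (tendsto_pow_atTop_nhds_zero_of_lt_one (by norm_num) (by norm_num)).const_mul _
  rw [mul_zero] at hlim
  exact abs_nonpos_iff.1 (ge_of_tendsto' hlim fun n => key n p hp)

/-- Passing to the copy multiplies the distance to the turning point by `10`, so a point at distance
at least `10⁻ⁿ` leaves the renormalization interval within `n` levels. There the ramps have a
definite sign. The two sign changes, from reversing orientation and from the factor `-1/10`, cancel.
-/
theorem tipSlope_sign_aux (n : ℕ) {p : ℕ → ℝ} (hp : Admissible p) {x : ℝ}
    (hx : x ∈ Icc (0 : ℝ) 1) (hn : (1 / 10 : ℝ) ^ n ≤ |x - tipCenter p|) :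
    0 < tipSlope p x * (tipCenter p - x) := by
  induction n generalizing p x with
  | zero =>
    have h := tipCenter_mem_Ioo hp
    have : |x - tipCenter p| < 1 := abs_lt.2 ⟨by linarith [hx.1, h.2], by linarith [hx.2, h.1]⟩
    rw [pow_zero] at hn
    linarith
  | succ n ih =>
    have hc := tipCenter_mem hp
    rcases le_total x (4 * p 0 - 2) with h | h
    · rw [tipSlope_left hp h]
      exact mul_pos (by linarith [(leftSlope_bounds (hp 0) x).1]) (by linarith [hc.1])
    rcases le_total x (4 * p 0 - 2 + 1 / 10) with h' | h'
    · obtain ⟨y, hy, rfl⟩ := exists_tipScale_eq ⟨h, h'⟩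
      have hd : tipScale (p 0) y - tipCenter p = -(1 / 10) * (y - tipCenter (shiftSeq p)) := by
        rw [tipCenter_eq hp, tipScale, tipScale]; ring
      rw [hd, abs_mul, abs_neg, abs_of_pos (show (0 : ℝ) < 1 / 10 by norm_num), pow_succ] at hn
      have := ih hp.shift hy (by linarith)
      rw [tipSlope_tipScale hp hy, ← neg_sub, hd]
      linarith
    · rw [tipSlope_right hp h']
      exact mul_pos_of_neg_of_neg (by linarith [(rightSlope_bounds (hp 0) (hp 1) x).2])
        (by linarith [hc.2])

theorem tipSlope_mul_pos {p : ℕ → ℝ} (hp : Admissible p) {x : ℝ}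
    (hx : x ∈ Icc (0 : ℝ) 1) (hxc : x ≠ tipCenter p) :
    0 < tipSlope p x * (tipCenter p - x) := by
  obtain ⟨n, hn⟩ := exists_pow_lt_of_lt_one (abs_pos.2 (sub_ne_zero.2 hxc))
    (show (1 / 10 : ℝ) < 1 by norm_num)
  exact tipSlope_sign_aux n hp hx hn.le

/-! ### The map, its self-similarity and its boundary values. -/

/-- The unimodal map with parameters `p`. -/
noncomputable def tipMap (p : ℕ → ℝ) (x : ℝ) : ℝ := 1 + ∫ t in tipCenter p..x, tipSlope p t

theorem hasDerivAt_tipMap {p : ℕ → ℝ} (hp : Admissible p) (x : ℝ) :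
    HasDerivAt (tipMap p) (tipSlope p x) x :=
  ((tipSlope_lipschitz hp).continuous.integral_hasStrictDerivAt _ x).hasDerivAt.const_add 1

theorem tipMap_tipCenter (p : ℕ → ℝ) : tipMap p (tipCenter p) = 1 := by simp [tipMap]

/-- Both sides have the same derivative in `y`, and both equal `1` at the turning point of the
shifted map. -/
theorem tipMap_tipScale {p : ℕ → ℝ} (hp : Admissible p) {y : ℝ} (hy : y ∈ Icc (0 : ℝ) 1) :
    tipMap p (tipScale (p 0) y) = 1 - (1 - tipMap (shiftSeq p) y) / 100 := by
  have hd : ∀ z, HasDerivAt (tipScale (p 0)) (-(1 / 10)) z := fun z => by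
    refine ((((hasDerivAt_id z).const_sub 1).div_const 10).const_add (4 * p 0 - 2)).congr_deriv ?_
    norm_num
  set c := tipCenter (shiftSeq p) with hc
  have hcmem : c ∈ Icc (0 : ℝ) 1 := Ioo_subset_Icc_self (tipCenter_mem_Ioo hp.shift)
  have hD : ∀ z ∈ Icc (0 : ℝ) 1, HasDerivWithinAt (fun z => tipMap p (tipScale (p 0) z) -
      tipMap (shiftSeq p) z / 100) 0 (Icc 0 1) z := by
    intro z hz
    have h1 := ((hasDerivAt_tipMap hp (tipScale (p 0) z)).comp z (hd z)).sub
      ((hasDerivAt_tipMap hp.shift z).div_const 100)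
    rw [tipSlope_tipScale hp hz] at h1
    refine (h1.congr_deriv ?_).hasDerivWithinAt
    ring
  have key := (convex_Icc (0 : ℝ) 1).norm_image_sub_le_of_norm_hasDerivWithin_le (C := 0) hD
    (fun z _ => by simp) hcmem hy
  rw [zero_mul, norm_le_zero_iff, sub_eq_zero] at key
  rw [hc, ← tipCenter_eq hp, tipMap_tipCenter, tipMap_tipCenter] at key
  linarith

/-- The mean of the left ramp was chosen for this: `p 0` is the intended value at `0`, and `99/100`
is the one at the left end of `I₂`, where the shifted map should take the value `0`. -/
theorem tipMap_left_sub {p : ℕ → ℝ} (hp : Admissible p) :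
    tipMap p (4 * p 0 - 2) - tipMap p 0 = 99 / 100 - p 0 := by
  have h1 := sub_eq_of_hasDerivAt_ramp (F := tipMap p) (x := 1 / 50) (y := 4 * p 0 - 2)
    (by linarith [(hp 0).1]) (fun z hz => (hasDerivAt_tipMap hp z).congr_deriv
      (tipSlope_left hp hz.2))
  have h2 : tipMap p (1 / 50) - tipMap p 0 = 5 / 4 * (1 / 50 - 0) := by
    refine sub_eq_of_hasDerivAt_ramp (d := 5 / 4) (e := 5 / 4) (by norm_num) fun z hz => ?_
    refine (hasDerivAt_tipMap hp z).congr_deriv ?_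
    rw [tipSlope_left hp (by linarith [hz.2, (hp 0).1]), leftSlope_zero (hp 0) hz.2]
    simp [ramp, quadInterp]
  rw [div_mul_cancel₀ _ (by linarith [(hp 0).1])] at h1
  linarith

theorem tipMap_sub_of_le {p : ℕ → ℝ} (hp : Admissible p) {x : ℝ} (hx : 0 ≤ x)
    (hx' : x ≤ 1 / 50) : tipMap p x - tipMap p 0 = 5 / 4 * x := by
  rcases hx.eq_or_lt with rfl | h
  · simp
  have h2 : tipMap p x - tipMap p 0 = 5 / 4 * (x - 0) := by
    refine sub_eq_of_hasDerivAt_ramp (d := 5 / 4) (e := 5 / 4) h fun z hz => ?_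
    refine (hasDerivAt_tipMap hp z).congr_deriv ?_
    rw [tipSlope_left hp (by linarith [hz.2, (hp 0).1]), leftSlope_zero (hp 0) (hz.2.trans hx')]
    simp [ramp, quadInterp]
  rwa [sub_zero] at h2

theorem tipMap_one_sub {p : ℕ → ℝ} (hp : Admissible p) {x : ℝ} (hx : p 0 ≤ x) (hx' : x ≤ 1) :
    tipMap p 1 - tipMap p x = -2 * (1 - x) := by
  rcases hx'.eq_or_lt with rfl | h
  · simp
  refine sub_eq_of_hasDerivAt_ramp (d := -2) (e := -2) h fun z hz => ?_
  refine (hasDerivAt_tipMap hp z).congr_deriv ?_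
  rw [tipSlope_right hp (by linarith [hz.1, (hp 0).2]), rightSlope_end (hp 0) (hx.trans hz.1)]
  simp [ramp, quadInterp]

theorem tipMap_right_sub {p : ℕ → ℝ} (hp : Admissible p) :
    tipMap p 1 - tipMap p (4 * p 0 - 2 + 1 / 10) = -1 + (1 - p 1) / 100 := by
  have h1 := sub_eq_of_hasDerivAt_ramp (F := tipMap p) (x := 4 * p 0 - 2 + 1 / 10) (y := p 0)
    (by linarith [(hp 0).2]) (fun z hz => (hasDerivAt_tipMap hp z).congr_deriv
      (tipSlope_right hp hz.1))
  rw [div_mul_cancel₀ _ (by linarith [(hp 0).2])] at h1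
  linarith [tipMap_one_sub hp le_rfl (by linarith [(hp 0).2])]

theorem abs_tipMap_le {p : ℕ → ℝ} (hp : Admissible p) {x : ℝ} (hx : x ∈ Icc (0 : ℝ) 1) :
    |tipMap p x| ≤ 21 := by
  have hc := tipCenter_mem_Ioo hp
  have h := intervalIntegral.norm_integral_le_of_norm_le_const (a := tipCenter p) (b := x)
    (f := tipSlope p) (C := 20) fun z _ => tipSlope_bound hp z
  have h1 : |x - tipCenter p| ≤ 1 := abs_le.2 ⟨by linarith [hx.1, hc.2], by linarith [hx.2, hc.1]⟩
  rw [Real.norm_eq_abs] at h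
  have h2 := abs_add_le 1 (∫ t in tipCenter p..x, tipSlope p t)
  rw [abs_one] at h2
  rw [tipMap]
  linarith

/-- The map is normalized at its turning point, so its end values must be deduced. The error at `0`
is `1/100` of the error at `1` for the shifted sequence, and vice versa, so both vanish in the
limit. -/
theorem tipMap_boundary_aux (n : ℕ) {p : ℕ → ℝ} (hp : Admissible p) :
    |tipMap p 0 - p 0| ≤ 22 * (1 / 100) ^ n ∧ |tipMap p 1| ≤ 22 * (1 / 100 : ℝ) ^ n := by
  induction n generalizing p with
  | zero =>
    have h0 := abs_le.1 (abs_tipMap_le hp (left_mem_Icc.2 zero_le_one))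
    have h1 := abs_tipMap_le hp (right_mem_Icc.2 zero_le_one)
    have h2 := hp 0
    exact ⟨abs_le.2 ⟨by linarith [h0.1, h2.2], by linarith [h0.2, h2.1]⟩, by linarith⟩
  | succ n ih =>
    obtain ⟨ih0, ih1⟩ := ih hp.shift
    have e1 := tipMap_tipScale hp (right_mem_Icc.2 zero_le_one)
    have e0 := tipMap_tipScale hp (left_mem_Icc.2 zero_le_one)
    rw [tipScale, sub_self, zero_div, add_zero] at e1
    rw [tipScale, sub_zero] at e0
    have hl := tipMap_left_sub hp
    have hr := tipMap_right_sub hp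
    have hs : p 1 = shiftSeq p 0 := rfl
    have k0 : tipMap p 0 - p 0 = 1 / 100 * tipMap (shiftSeq p) 1 := by linarith
    have k1 : tipMap p 1 = 1 / 100 * (tipMap (shiftSeq p) 0 - shiftSeq p 0) := by linarith
    rw [k0, k1, abs_mul, abs_mul, abs_of_pos (show (0 : ℝ) < 1 / 100 by norm_num), pow_succ]
    constructor <;> linarith

theorem tipMap_boundary {p : ℕ → ℝ} (hp : Admissible p) : tipMap p 0 = p 0 ∧ tipMap p 1 = 0 := by
  have hlim : Tendsto (fun n : ℕ => 22 * (1 / 100 : ℝ) ^ n) atTop (𝓝 (22 * 0)) :=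
    (tendsto_pow_atTop_nhds_zero_of_lt_one (by norm_num) (by norm_num)).const_mul _
  rw [mul_zero] at hlim
  exact ⟨sub_eq_zero.1 (abs_nonpos_iff.1
      (ge_of_tendsto' hlim fun n => (tipMap_boundary_aux n hp).1)),
    abs_nonpos_iff.1 (ge_of_tendsto' hlim fun n => (tipMap_boundary_aux n hp).2)⟩

theorem tipMap_of_le {p : ℕ → ℝ} (hp : Admissible p) {x : ℝ} (hx : 0 ≤ x)
    (hx' : x ≤ 1 / 50) : tipMap p x = p 0 + 5 / 4 * x := by
  linarith [tipMap_sub_of_le hp hx hx', (tipMap_boundary hp).1]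

theorem tipMap_of_ge {p : ℕ → ℝ} (hp : Admissible p) {x : ℝ} (hx : p 0 ≤ x) (hx' : x ≤ 1) :
    tipMap p x = 2 * (1 - x) := by
  linarith [tipMap_one_sub hp hx hx', (tipMap_boundary hp).2]

/-! ### Unimodality and regularity. -/

theorem derivWithin_eq_tipSlope {p : ℕ → ℝ} (hp : Admissible p) {f : ℝ → ℝ}
    (hf : EqOn f (tipMap p) (Icc 0 1)) {x : ℝ} (hx : x ∈ Icc (0 : ℝ) 1) :
    derivWithin f (Icc 0 1) x = tipSlope p x :=
  ((hasDerivAt_tipMap hp x).hasDerivWithinAt.congr hf (hf hx)).derivWithin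
    (uniqueDiffOn_Icc zero_lt_one x hx)

theorem strictMonoOn_tipMap {p : ℕ → ℝ} (hp : Admissible p) :
    StrictMonoOn (tipMap p) (Icc 0 (tipCenter p)) := by
  have hc := tipCenter_mem_Ioo hp
  refine strictMonoOn_of_deriv_pos (convex_Icc _ _)
    (fun x _ => (hasDerivAt_tipMap hp x).continuousAt.continuousWithinAt) fun x hx => ?_
  rw [interior_Icc] at hx
  rw [(hasDerivAt_tipMap hp x).deriv]
  exact pos_of_mul_pos_left (tipSlope_mul_pos hp ⟨hx.1.le, hx.2.le.trans hc.2.le⟩ hx.2.ne)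
    (by linarith [hx.2])

theorem strictAntiOn_tipMap {p : ℕ → ℝ} (hp : Admissible p) :
    StrictAntiOn (tipMap p) (Icc (tipCenter p) 1) := by
  have hc := tipCenter_mem_Ioo hp
  refine strictAntiOn_of_deriv_neg (convex_Icc _ _)
    (fun x _ => (hasDerivAt_tipMap hp x).continuousAt.continuousWithinAt) fun x hx => ?_
  rw [interior_Icc] at hx
  rw [(hasDerivAt_tipMap hp x).deriv]
  have := tipSlope_mul_pos hp ⟨hc.1.le.trans hx.1.le, hx.2.le⟩ hx.1.ne'
  by_contra! h
  nlinarith [hx.1]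

theorem mapsTo_tipMap {p : ℕ → ℝ} (hp : Admissible p) :
    MapsTo (tipMap p) (Icc 0 1) (Icc 0 1) := by
  have hc := tipCenter_mem_Ioo hp
  intro x hx
  rcases le_total x (tipCenter p) with h | h
  · have h1 := (strictMonoOn_tipMap hp).monotoneOn (left_mem_Icc.2 hc.1.le) ⟨hx.1, h⟩ hx.1
    have h2 := (strictMonoOn_tipMap hp).monotoneOn ⟨hx.1, h⟩ (right_mem_Icc.2 hc.1.le) h
    rw [(tipMap_boundary hp).1] at h1
    rw [tipMap_tipCenter] at h2
    exact ⟨by linarith [(hp 0).1], h2⟩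
  · have h1 := (strictAntiOn_tipMap hp).antitoneOn ⟨h, hx.2⟩ (right_mem_Icc.2 hc.2.le) hx.2
    have h2 := (strictAntiOn_tipMap hp).antitoneOn (left_mem_Icc.2 hc.2.le) ⟨h, hx.2⟩ h
    rw [(tipMap_boundary hp).2] at h1
    rw [tipMap_tipCenter] at h2
    exact ⟨h1, h2⟩

theorem isUnimodal_of_eqOn_tipMap {p : ℕ → ℝ} (hp : Admissible p) {f : ℝ → ℝ}
    (hf : EqOn f (tipMap p) (Icc 0 1)) : IsUnimodal f (tipCenter p) where
  mapsTo := (mapsTo_tipMap hp).congr hf.symm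
  contDiffOn := by
    have h : ContDiff ℝ 1 (tipMap p) := by
      refine contDiff_one_iff_deriv.2
        ⟨fun x => (hasDerivAt_tipMap hp x).differentiableAt, ?_⟩
      rw [show deriv (tipMap p) = tipSlope p from funext fun x => (hasDerivAt_tipMap hp x).deriv]
      exact (tipSlope_lipschitz hp).continuous
    exact h.contDiffOn.congr hf
  mem_Ioo := tipCenter_mem_Ioo hp
  critical_iff x hx := by
    rw [derivWithin_eq_tipSlope hp hf hx]
    refine ⟨fun h => ?_, fun h => h ▸ tipSlope_tipCenter hp⟩
    by_contra hne
    have := tipSlope_mul_pos hp hx hne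
    rw [h, zero_mul] at this
    exact this.false
  strictMonoOn := (strictMonoOn_tipMap hp).congr
    (hf.symm.mono (Icc_subset_Icc_right (tipCenter_mem_Ioo hp).2.le))
  strictAntiOn := (strictAntiOn_tipMap hp).congr
    (hf.symm.mono (Icc_subset_Icc_left (tipCenter_mem_Ioo hp).1.le))

theorem isC1Lip_tipMap {p : ℕ → ℝ} (hp : Admissible p) : IsC1Lip (tipMap p) := by
  refine ⟨fun x _ => (hasDerivAt_tipMap hp x).differentiableAt.differentiableWithinAt, 300, ?_⟩
  intro x hx y hy
  rw [derivWithin_eq_tipSlope hp (eqOn_refl _ _) hx, derivWithin_eq_tipSlope hp (eqOn_refl _ _) hy]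
  exact tipSlope_lipschitz hp x y

/-! ### Renormalization acts as the shift. -/

theorem tipScale_mem_Icc {u y : ℝ} (hu : u ∈ Icc (29 / 50 : ℝ) (61 / 100))
    (hy : y ∈ Icc (0 : ℝ) 1) : tipScale u y ∈ Icc (0 : ℝ) 1 :=
  ⟨by linarith [(tipScale_mem (u := u) hy).1, hu.1],
    by linarith [(tipScale_mem (u := u) hy).2, hu.2]⟩

theorem tipScale_injective (u : ℝ) : Function.Injective (tipScale u) := fun x y h => by
  rw [tipScale, tipScale] at h
  linarith

/-- The orbit follows `I₅ → I₁ → I₃ → I₄ → I₂`. Only the two affine branches of the map are met,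
since `I₁` lies in `[0, 1/50]` and `I₃`, `I₄`, `I₅` lie in `[p 0, 1]`. -/
theorem tip_orbit {p : ℕ → ℝ} (hp : Admissible p) {f : ℝ → ℝ}
    (hf : EqOn f (tipMap p) (Icc 0 1)) {w : ℝ} (hw : w ∈ Icc (0 : ℝ) 1) :
    f (1 - w / 100) = w / 50 ∧ f (w / 50) = p 0 + w / 40 ∧
      f (p 0 + w / 40) = 2 * (1 - p 0) - w / 20 ∧
      f (2 * (1 - p 0) - w / 20) = tipScale (p 0) (1 - w) := by
  obtain ⟨h1, h2⟩ := hw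
  obtain ⟨h3, h4⟩ := hp 0
  refine ⟨?_, ?_, ?_, ?_⟩
  · rw [hf ⟨by linarith, by linarith⟩, tipMap_of_ge hp (by linarith) (by linarith)]
    ring
  · rw [hf ⟨by linarith, by linarith⟩, tipMap_of_le hp (by linarith) (by linarith)]
    ring
  · rw [hf ⟨by linarith, by linarith⟩, tipMap_of_ge hp (by linarith) (by linarith)]
    ring
  · rw [hf ⟨by linarith, by linarith⟩, tipMap_of_ge hp (by linarith) (by linarith), tipScale]
    ring

theorem iterate_tipScale {p : ℕ → ℝ} (hp : Admissible p) {f : ℝ → ℝ}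
    (hf : EqOn f (tipMap p) (Icc 0 1)) {y : ℝ} (hy : y ∈ Icc (0 : ℝ) 1) :
    f (tipScale (p 0) y) = 1 - (1 - tipMap (shiftSeq p) y) / 100 ∧
      f^[2] (tipScale (p 0) y) = (1 - tipMap (shiftSeq p) y) / 50 ∧
      f^[3] (tipScale (p 0) y) = p 0 + (1 - tipMap (shiftSeq p) y) / 40 ∧
      f^[4] (tipScale (p 0) y) = 2 * (1 - p 0) - (1 - tipMap (shiftSeq p) y) / 20 ∧
      f^[5] (tipScale (p 0) y) = tipScale (p 0) (tipMap (shiftSeq p) y) := by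
  have hv := mapsTo_tipMap hp.shift hy
  have h0 : f (tipScale (p 0) y) = 1 - (1 - tipMap (shiftSeq p) y) / 100 := by
    rw [hf (tipScale_mem_Icc (hp 0) hy), tipMap_tipScale hp hy]
  obtain ⟨h1, h2, h3, h4⟩ := tip_orbit hp hf (w := 1 - tipMap (shiftSeq p) y)
    ⟨by linarith [hv.2], by linarith [hv.1]⟩
  rw [sub_sub_cancel] at h4
  simp only [Function.iterate_succ_apply, Function.iterate_zero_apply, h0, h1, h2, h3, h4, and_self]

theorem iterate_zero_tip {p : ℕ → ℝ} (hp : Admissible p) {f : ℝ → ℝ}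
    (hf : EqOn f (tipMap p) (Icc 0 1)) :
    f^[3] 0 = 4 * p 0 - 2 ∧ f^[8] 0 = 4 * p 0 - 2 + 1 / 10 := by
  obtain ⟨-, h2, h3, h4⟩ := tip_orbit hp hf (left_mem_Icc.2 zero_le_one)
  rw [zero_div, zero_div, add_zero] at h2
  rw [zero_div, zero_div, add_zero, sub_zero] at h3
  rw [zero_div, sub_zero, sub_zero] at h4
  have h : f^[3] 0 = tipScale (p 0) 1 := by
    simp only [Function.iterate_succ_apply, Function.iterate_zero_apply, h2, h3, h4]
  refine ⟨by rw [h, tipScale]; ring, ?_⟩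
  rw [show f^[8] 0 = f^[5] (f^[3] 0) from rfl, h,
    (iterate_tipScale hp hf (right_mem_Icc.2 zero_le_one)).2.2.2.2, (tipMap_boundary hp.shift).2,
    tipScale, sub_zero]

theorem quintInterval_tip {p : ℕ → ℝ} (hp : Admissible p) {f : ℝ → ℝ}
    (hf : EqOn f (tipMap p) (Icc 0 1)) :
    quintInterval f = Icc (4 * p 0 - 2) (4 * p 0 - 2 + 1 / 10) := by
  rw [quintInterval, (iterate_zero_tip hp hf).1, (iterate_zero_tip hp hf).2]

theorem quintRenorm_tip {p : ℕ → ℝ} (hp : Admissible p) {f : ℝ → ℝ}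
    (hf : EqOn f (tipMap p) (Icc 0 1)) :
    EqOn (quintRenorm f) (tipMap (shiftSeq p)) (Icc 0 1) := by
  intro x hx
  obtain ⟨h3, h8⟩ := iterate_zero_tip hp hf
  have hs : quintScale f x = tipScale (p 0) x := by
    rw [quintScale, tipScale, h3, h8]; ring
  rw [quintRenorm, hs, (iterate_tipScale hp hf hx).2.2.2.2, quintScaleInv, h3, h8, tipScale]
  field_simp
  ring

theorem isQuintRenormalizable_tip {p : ℕ → ℝ} (hp : Admissible p) {f : ℝ → ℝ}
    (hf : EqOn f (tipMap p) (Icc 0 1)) : IsQuintRenormalizable f := by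
  obtain ⟨h3, h8⟩ := iterate_zero_tip hp hf
  have hc := tipCenter_mem hp
  obtain ⟨hp1, hp2⟩ := hp 0
  refine ⟨tipCenter p, isUnimodal_of_eqOn_tipMap hp hf, ?_, ?_, by rw [h3]; exact hc.1,
    by rw [h8]; exact hc.2, ?_⟩
  · rw [hf (Ioo_subset_Icc_self (tipCenter_mem_Ioo hp)), tipMap_tipCenter]
  · rw [hf (right_mem_Icc.2 zero_le_one), (tipMap_boundary hp).2]
  have key : ∀ x ∈ quintInterval f, ∃ w ∈ Icc (0 : ℝ) 1, f x = 1 - w / 100 ∧ f^[2] x = w / 50 ∧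
      f^[3] x = p 0 + w / 40 ∧ f^[4] x = 2 * (1 - p 0) - w / 20 ∧
      f^[5] x = tipScale (p 0) (1 - w) := by
    intro x hx
    rw [quintInterval_tip hp hf] at hx
    obtain ⟨y, hy, rfl⟩ := exists_tipScale_eq hx
    have hv := mapsTo_tipMap hp.shift hy
    refine ⟨1 - tipMap (shiftSeq p) y, ⟨by linarith [hv.2], by linarith [hv.1]⟩, ?_⟩
    rw [sub_sub_cancel]
    exact iterate_tipScale hp hf hy
  rw [quintInterval_tip hp hf] at key ⊢
  refine ⟨Icc_subset_Icc (by linarith) (by linarith), ?_, ?_, ?_, ?_, ?_⟩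
  · intro x hx
    obtain ⟨w, hw, -, -, -, -, h⟩ := key x hx
    rw [h]
    exact tipScale_mem ⟨by linarith [hw.2], by linarith [hw.1]⟩
  · rintro _ ⟨x, hx, rfl⟩ y hy
    obtain ⟨w, hw, -, h, -⟩ := key x hx
    linarith [hy.1, hw.2]
  · rintro y hy _ ⟨x, hx, rfl⟩
    obtain ⟨w, hw, -, -, h, -⟩ := key x hx
    linarith [hy.2, hw.1]
  · rintro _ ⟨x, hx, rfl⟩ _ ⟨x', hx', rfl⟩
    obtain ⟨w, hw, -, -, h, -⟩ := key x hx
    obtain ⟨w', hw', -, -, -, h', -⟩ := key x' hx'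
    linarith [hw.2, hw'.2]
  · rintro _ ⟨x, hx, rfl⟩ _ ⟨x', hx', rfl⟩
    obtain ⟨w, hw, -, -, -, h, -⟩ := key x hx
    obtain ⟨w', hw', h', -⟩ := key x' hx'
    linarith [hw.1, hw'.2]

theorem Admissible.iterate_shift {p : ℕ → ℝ} (hp : Admissible p) (n : ℕ) :
    Admissible (shiftSeq^[n] p) := by
  induction n with
  | zero => exact hp
  | succ n ih => rw [Function.iterate_succ_apply']; exact ih.shift

theorem iterate_quintRenorm_tip {p : ℕ → ℝ} (hp : Admissible p) (n : ℕ) :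
    EqOn (quintRenorm^[n] (tipMap p)) (tipMap (shiftSeq^[n] p)) (Icc 0 1) := by
  induction n with
  | zero => exact eqOn_refl _ _
  | succ n ih =>
    rw [Function.iterate_succ_apply', Function.iterate_succ_apply']
    exact quintRenorm_tip (hp.iterate_shift n) ih

/-! ### Nested intervals and disjointness of their images. -/

/-- The end points of the nested renormalization intervals. -/
noncomputable def nestEnds : ℕ → (ℕ → ℝ) → ℝ × ℝ
  | 0, _ => (0, 1)
  | n + 1, p => (tipScale (p 0) (nestEnds n (shiftSeq p)).2,
      tipScale (p 0) (nestEnds n (shiftSeq p)).1)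

theorem nestEnds_sub (n : ℕ) (p : ℕ → ℝ) :
    (nestEnds n p).2 - (nestEnds n p).1 = (1 / 10) ^ n := by
  induction n generalizing p with
  | zero => simp [nestEnds]
  | succ n ih =>
    have := ih (shiftSeq p)
    simp only [nestEnds, tipScale]
    rw [pow_succ]
    linarith

/-- The nested renormalization intervals. -/
def nest (n : ℕ) (p : ℕ → ℝ) : Set ℝ := Icc (nestEnds n p).1 (nestEnds n p).2

theorem nest_succ (n : ℕ) (p : ℕ → ℝ) :
    nest (n + 1) p = tipScale (p 0) '' nest n (shiftSeq p) := by
  ext x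
  constructor
  · rintro ⟨h1, h2⟩
    simp only [nestEnds, tipScale] at h1 h2
    exact ⟨10 * (4 * p 0 - 2 + 1 / 10 - x), ⟨by linarith, by linarith⟩, by rw [tipScale]; ring⟩
  · rintro ⟨y, ⟨h1, h2⟩, rfl⟩
    constructor <;> simp only [nestEnds, tipScale] <;> linarith

theorem nest_subset (n : ℕ) {p : ℕ → ℝ} (hp : Admissible p) : nest n p ⊆ Icc 0 1 := by
  induction n generalizing p with
  | zero => exact subset_rfl
  | succ n ih =>
    rw [nest_succ]
    rintro _ ⟨y, hy, rfl⟩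
    exact tipScale_mem_Icc (hp 0) (ih hp.shift hy)

theorem nest_antitone (n : ℕ) {p : ℕ → ℝ} (hp : Admissible p) : nest (n + 1) p ⊆ nest n p := by
  induction n generalizing p with
  | zero => exact nest_subset 1 hp
  | succ n ih =>
    rw [nest_succ (n + 1) p, nest_succ n p]
    exact image_mono (ih hp.shift)

theorem iterate_mul_tipScale {p : ℕ → ℝ} (hp : Admissible p) (q : ℕ) {y : ℝ}
    (hy : y ∈ Icc (0 : ℝ) 1) :
    (tipMap p)^[5 * q] (tipScale (p 0) y) = tipScale (p 0) ((tipMap (shiftSeq p))^[q] y) := by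
  induction q with
  | zero => rfl
  | succ q ih =>
    rw [mul_add, mul_one, add_comm, Function.iterate_add_apply, ih,
      (iterate_tipScale hp (eqOn_refl _ _) ((mapsTo_tipMap hp.shift).iterate q hy)).2.2.2.2,
      Function.iterate_succ_apply']

theorem mapsTo_nest (n : ℕ) {p : ℕ → ℝ} (hp : Admissible p) :
    MapsTo (tipMap p)^[5 ^ n] (nest n p) (nest n p) := by
  induction n generalizing p with
  | zero => exact mapsTo_tipMap hp
  | succ n ih =>
    rw [nest_succ]
    rintro _ ⟨y, hy, rfl⟩
    rw [pow_succ', iterate_mul_tipScale hp _ (nest_subset n hp.shift hy)]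
    exact mem_image_of_mem _ (ih hp.shift hy)

theorem iterate_tipScale_ne {p : ℕ → ℝ} (hp : Admissible p) {s t : ℕ} (hs : s < 5) (ht : t < 5)
    {x y : ℝ} (hx : x ∈ Icc (0 : ℝ) 1) (hy : y ∈ Icc (0 : ℝ) 1)
    (h : (tipMap p)^[s] (tipScale (p 0) x) = (tipMap p)^[t] (tipScale (p 0) y)) : s = t := by
  obtain ⟨a1, a2, a3, a4, -⟩ := iterate_tipScale hp (eqOn_refl _ _) hx
  obtain ⟨b1, b2, b3, b4, -⟩ := iterate_tipScale hp (eqOn_refl _ _) hy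
  have a0 := tipScale_mem (u := p 0) hx
  have b0 := tipScale_mem (u := p 0) hy
  have hv := mapsTo_tipMap hp.shift hx
  have hw := mapsTo_tipMap hp.shift hy
  obtain ⟨h1, h2⟩ := hp 0
  obtain ⟨a01, a02⟩ := a0
  obtain ⟨b01, b02⟩ := b0
  obtain ⟨hv1, hv2⟩ := hv
  obtain ⟨hw1, hw2⟩ := hw
  interval_cases s <;> interval_cases t <;>
    first
    | rfl
    | (exfalso
       try simp only [Function.iterate_one, Function.iterate_zero_apply] at h
       linarith)

/-- The residues of `i` and `j` modulo `5` tell which of the five disjoint intervals is visited, so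
a coincidence forces equal residues. It then descends to a coincidence for the shifted map one level
down. -/
theorem iterate_nest_ne (n : ℕ) {p : ℕ → ℝ} (hp : Admissible p) {i j : ℕ} (hij : i < j)
    (hj : j < 5 ^ n) {x y : ℝ} (hx : x ∈ nest n p) (hy : y ∈ nest n p) :
    (tipMap p)^[i] x ≠ (tipMap p)^[j] y := by
  induction n generalizing p i j x y with
  | zero => omega
  | succ n ih =>
    rw [nest_succ] at hx hy
    obtain ⟨x, hx, rfl⟩ := hx
    obtain ⟨y, hy, rfl⟩ := hy
    intro h
    have hx' := nest_subset n hp.shift hx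
    have hy' := nest_subset n hp.shift hy
    have hX := (mapsTo_tipMap hp.shift).iterate (i / 5) hx'
    have hY := (mapsTo_tipMap hp.shift).iterate (j / 5) hy'
    rw [← Nat.mod_add_div i 5, ← Nat.mod_add_div j 5, Function.iterate_add_apply,
      Function.iterate_add_apply, iterate_mul_tipScale hp _ hx', iterate_mul_tipScale hp _ hy'] at h
    have hmod := iterate_tipScale_ne hp (Nat.mod_lt _ (by norm_num)) (Nat.mod_lt _ (by norm_num))
      hX hY h
    -- Completing the round back to `I₂` makes the injectivity of `tipScale` available, at the price
    -- of one more iterate of the shifted map on each side.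
    have h5 := congrArg (tipMap p)^[5 - i % 5] h
    rw [hmod, ← Function.iterate_add_apply, ← Function.iterate_add_apply,
      Nat.sub_add_cancel (Nat.mod_lt _ (by norm_num)).le,
      (iterate_tipScale hp (eqOn_refl _ _) hX).2.2.2.2,
      (iterate_tipScale hp (eqOn_refl _ _) hY).2.2.2.2] at h5
    have h6 := tipScale_injective _ h5
    rw [← Function.iterate_succ_apply' (tipMap (shiftSeq p)),
      ← Function.iterate_succ_apply' (tipMap (shiftSeq p))] at h6
    rw [pow_succ] at hj
    have hlt : i / 5 + 1 < j / 5 + 1 := by omega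
    have hle : j / 5 + 1 ≤ 5 ^ n := by omega
    -- The extra iterate may complete the full period `5 ^ n`. The image of `y` is then back in the
    -- nest and serves as a new point with iterate `0`.
    rcases hle.lt_or_eq with h7 | h7
    · exact ih hp.shift hlt h7 hx hy h6
    · rw [Nat.succ_eq_add_one, Nat.succ_eq_add_one, h7] at h6
      exact ih hp.shift (Nat.succ_pos (i / 5)) (by omega) (mapsTo_nest n hp.shift hy) hx h6.symm

theorem isInfinitelyRenormalizable_tip {p : ℕ → ℝ} (hp : Admissible p) :
    IsInfinitelyRenormalizable (tipMap p) (fun n => 5 ^ (n + 1)) := by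
  refine ⟨fun n => (nestEnds (n + 1) p).1, fun n => (nestEnds (n + 1) p).2, fun n => ?_,
    fun n => nest_antitone (n + 1) hp, ?_⟩
  · have hlen := nestEnds_sub (n + 1) p
    have hpos : (0 : ℝ) < (1 / 10) ^ (n + 1) := by positivity
    refine ⟨by positivity, by linarith, ⟨nest_subset (n + 1) hp, fun h => ?_⟩, ?_,
      mapsTo_nest (n + 1) hp⟩
    · have h0 : (0 : ℝ) ∈ nest (n + 1) p := h (left_mem_Icc.2 zero_le_one)
      rw [nest_succ] at h0
      obtain ⟨y, hy, h0⟩ := h0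
      linarith [(tipScale_mem (u := p 0) (nest_subset n hp.shift hy)).1, (hp 0).1]
    · intro i hi j hj hij
      refine Disjoint.mono interior_subset interior_subset (disjoint_left.2 ?_)
      rintro _ ⟨x, hx, rfl⟩ ⟨y, hy, h⟩
      rcases hij.lt_or_gt with h' | h'
      · exact iterate_nest_ne (n + 1) hp h' hj hx hy h.symm
      · exact iterate_nest_ne (n + 1) hp h' hi hy hx h
  · simp only [nestEnds_sub]
    exact (tendsto_add_atTop_iff_nat 1).2
      (tendsto_pow_atTop_nhds_zero_of_lt_one (by norm_num) (by norm_num))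

theorem isInfinitelyQuintRenormalizable_tip {p : ℕ → ℝ} (hp : Admissible p) :
    IsInfinitelyQuintRenormalizable (tipMap p) :=
  ⟨fun n => isQuintRenormalizable_tip (hp.iterate_shift n) (iterate_quintRenorm_tip hp n),
    isInfinitelyRenormalizable_tip hp⟩

/-! ### The quadratic tip. -/

/-- The end points of the nested intervals that correspond to the point `1`. -/
noncomputable def tipPoint : ℕ → (ℕ → ℝ) → ℝ
  | 0, _ => 1
  | n + 1, p => tipScale (p 0) (tipPoint n (shiftSeq p))

theorem tipPoint_mem (n : ℕ) {p : ℕ → ℝ} (hp : Admissible p) : tipPoint n p ∈ Icc (0 : ℝ) 1 := by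
  induction n generalizing p with
  | zero => exact right_mem_Icc.2 zero_le_one
  | succ n ih => exact tipScale_mem_Icc (hp 0) (ih hp.shift)

theorem tipPoint_sub (n : ℕ) {p : ℕ → ℝ} (hp : Admissible p) :
    tipPoint n p - tipCenter p = (-(1 / 10)) ^ n * (1 - tipCenter (shiftSeq^[n] p)) := by
  induction n generalizing p with
  | zero => simp [tipPoint]
  | succ n ih =>
    rw [Function.iterate_succ_apply, pow_succ, mul_right_comm, ← ih hp.shift, tipCenter_eq hp,
      tipPoint, tipScale, tipScale]
    ring

theorem tipMap_tipPoint (n : ℕ) {p : ℕ → ℝ} (hp : Admissible p) :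
    tipMap p (tipPoint n p) = 1 - (1 / 100) ^ n := by
  induction n generalizing p with
  | zero => simp [tipPoint, (tipMap_boundary hp).2]
  | succ n ih =>
    rw [tipPoint, tipMap_tipScale hp (tipPoint_mem n hp.shift), ih hp.shift, pow_succ]
    ring

/-- At `tipPoint n p` the difference quotient is exactly `-1 / (1 - cₙ)²`, where `cₙ` is the turning
point for the `n`-th shift. The `cₙ` stay in a compact set away from `1`, so it converges along a
subsequence. -/
theorem hasQuadraticTip_tip {p : ℕ → ℝ} (hp : Admissible p) :
    HasQuadraticTip (tipMap p) (tipCenter p) := by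
  obtain ⟨c, hc, φ, hφ, hlim⟩ := (isCompact_Icc (a := (0 : ℝ)) (b := 13 / 20)).tendsto_subseq
    (x := fun n => tipCenter (shiftSeq^[n] p)) fun n => by
      have h1 := tipCenter_mem_Ioo (hp.iterate_shift n)
      have h2 := tipCenter_mem (hp.iterate_shift n)
      exact ⟨h1.1.le, by linarith [h2.2, (hp.iterate_shift n 0).2]⟩
  have hc1 : 0 < 1 - c := by linarith [hc.2]
  have hpos : ∀ n, 0 < 1 - tipCenter (shiftSeq^[n] p) := fun n => by
    linarith [(tipCenter_mem_Ioo (hp.iterate_shift n)).2]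
  refine ⟨fun n => tipPoint (φ n) p, 1 / (1 - c) ^ 2,
    fun n => ⟨tipPoint_mem _ hp, fun h => ?_⟩, ?_, by positivity, ?_⟩
  · have h1 := tipPoint_sub (φ n) hp
    rw [show tipPoint (φ n) p = tipCenter p from h, sub_self] at h1
    exact mul_ne_zero (pow_ne_zero _ (by norm_num)) (hpos _).ne' h1.symm
  · have h0 : Tendsto (fun n => (-(1 / 10) : ℝ) ^ φ n) atTop (𝓝 0) :=
      (tendsto_pow_atTop_nhds_zero_of_abs_lt_one (by norm_num [abs_lt])).comp hφ.tendsto_atTop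
    have h1 := (h0.mul (hlim.const_sub 1)).add_const (tipCenter p)
    rw [zero_mul, zero_add] at h1
    refine h1.congr fun n => ?_
    simp only [Function.comp_apply]
    rw [← tipPoint_sub _ hp, sub_add_cancel]
  · have h1 := ((tendsto_const_nhds (x := (1 : ℝ))).div ((hlim.const_sub 1).pow 2)
      (by positivity)).neg
    refine h1.congr fun n => ?_
    simp only [Function.comp_apply]
    have h2 := (hpos (φ n)).ne'
    rw [tipMap_tipPoint _ hp, tipMap_tipCenter, tipPoint_sub _ hp, mul_pow, ← pow_mul,
      mul_comm (φ n), pow_mul]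
    norm_num
    field_simp

/-! ### The Cantor set of turning points. -/

/-- The sequence of parameters given by a binary code. -/
noncomputable def codeParam (w : ℕ → Bool) : ℕ → ℝ := fun n => if w n then 61 / 100 else 29 / 50

theorem admissible_codeParam (w : ℕ → Bool) : Admissible (codeParam w) := fun n => by
  unfold codeParam
  split_ifs <;> constructor <;> norm_num

theorem iterate_shift_codeParam (w : ℕ → Bool) (n : ℕ) :
    shiftSeq^[n] (codeParam w) = codeParam fun k => w (n + k) := by
  induction n generalizing w with
  | zero => simp
  | succ n ih =>
    rw [Function.iterate_succ_apply, show shiftSeq (codeParam w) =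
      codeParam (fun k => w (k + 1)) from rfl, ih]
    congr 1
    ext k
    congr 1
    ring

/-- The turning point given by a binary code. -/
noncomputable def codeCenter (w : ℕ → Bool) : ℝ := tipCenter (codeParam w)

theorem codeCenter_eq (w : ℕ → Bool) :
    codeCenter w = tipScale (codeParam w 0) (codeCenter fun k => w (k + 1)) :=
  tipCenter_eq (admissible_codeParam w)

theorem abs_codeCenter_sub_le (n : ℕ) {v w : ℕ → Bool} (h : ∀ k < n, v k = w k) :
    |codeCenter v - codeCenter w| ≤ (1 / 10) ^ n := by
  induction n generalizing v w with
  | zero =>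
    have h1 := tipCenter_mem_Ioo (admissible_codeParam v)
    have h2 := tipCenter_mem_Ioo (admissible_codeParam w)
    rw [pow_zero]
    exact abs_le.2 ⟨by unfold codeCenter; linarith [h1.1, h2.2],
      by unfold codeCenter; linarith [h1.2, h2.1]⟩
  | succ n ih =>
    have h0 : codeParam v 0 = codeParam w 0 := by simp [codeParam, h 0 n.succ_pos]
    have h1 := ih (v := fun k => v (k + 1)) (w := fun k => w (k + 1))
      fun k hk => h (k + 1) (Nat.succ_lt_succ hk)
    rw [codeCenter_eq v, codeCenter_eq w, h0, tipScale, tipScale, add_sub_add_left_eq_sub,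
      ← sub_div, sub_sub_sub_cancel_left, abs_div, abs_sub_comm, pow_succ,
      abs_of_pos (show (0 : ℝ) < 10 by norm_num)]
    linarith

/-- The renormalization intervals for the two parameter values, `[0.32, 0.42]` and `[0.44, 0.54]`,
are disjoint. -/
theorem codeCenter_head {v w : ℕ → Bool} (h : codeCenter v = codeCenter w) : v 0 = w 0 := by
  have h1 := tipCenter_mem (admissible_codeParam v)
  have h2 := tipCenter_mem (admissible_codeParam w)
  rw [codeCenter, codeCenter] at h
  rw [h] at h1
  have h3 := h1.1.trans h2.2
  have h4 := h2.1.trans h1.2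
  unfold codeParam at h3 h4
  cases hv : v 0 <;> cases hw : w 0 <;>
    first
    | rfl
    | (rw [hv, hw] at h3 h4; norm_num at h3 <;> norm_num at h4)

theorem codeCenter_injective : Function.Injective codeCenter := by
  have key : ∀ n : ℕ, ∀ v w : ℕ → Bool, codeCenter v = codeCenter w → v n = w n := by
    intro n
    induction n with
    | zero => exact fun v w h => codeCenter_head h
    | succ n ih =>
      intro v w h
      have h0 : codeParam v 0 = codeParam w 0 := by simp [codeParam, codeCenter_head h]
      rw [codeCenter_eq v, codeCenter_eq w, h0] at h
      exact ih _ _ (tipScale_injective _ h)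
  exact fun v w h => funext fun n => key n v w h

theorem continuous_codeCenter : Continuous codeCenter := by
  refine continuous_tsum (u := fun k => (1 / 10 : ℝ) ^ k) (fun k => ?_)
    (summable_geometric_of_lt_one (by norm_num) (by norm_num)) fun k w => ?_
  · have h : Continuous fun w : ℕ → Bool => codeParam w k :=
      (continuous_of_discreteTopology (f := fun b : Bool =>
        if b then (61 / 100 : ℝ) else 29 / 50)).comp (continuous_apply k)
    fun_prop
  · have h := admissible_codeParam w k
    rw [norm_mul, norm_pow, norm_neg, Real.norm_of_nonneg (show (0 : ℝ) ≤ 1 / 10 by norm_num),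
      Real.norm_of_nonneg (by linarith [h.1])]
    exact mul_le_of_le_one_right (by positivity) (by linarith [h.2])

theorem exists_pow_lt_of_mem_nhds {x : ℝ} {U : Set ℝ} (hU : U ∈ 𝓝 x) :
    ∃ n : ℕ, ∀ y, |y - x| ≤ (1 / 10) ^ n → y ∈ U := by
  obtain ⟨ε, hε, h⟩ := Metric.mem_nhds_iff.1 hU
  obtain ⟨n, hn⟩ := exists_pow_lt_of_lt_one hε (show (1 / 10 : ℝ) < 1 by norm_num)
  exact ⟨n, fun y hy => h (Metric.mem_ball.2 (by rw [Real.dist_eq]; linarith))⟩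

theorem isCantorSet_range_codeCenter : IsCantorSet (range codeCenter) := by
  have hcomp : IsCompact (range codeCenter) := isCompact_range continuous_codeCenter
  refine ⟨range_nonempty _, hcomp, ⟨hcomp.isClosed, ?_⟩,
    (continuous_codeCenter.isClosedEmbedding codeCenter_injective).isEmbedding
      |>.isTotallyDisconnected_range.2 inferInstance⟩
  rintro _ ⟨w, rfl⟩
  rw [accPt_iff_nhds]
  intro U hU
  obtain ⟨n, hn⟩ := exists_pow_lt_of_mem_nhds hU
  -- Flipping the digit at `n` gives a different point of the set within `10⁻ⁿ`, so no point is
  -- isolated.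
  refine ⟨codeCenter (Function.update w n (!w n)), ⟨hn _ (abs_codeCenter_sub_le n fun k hk => ?_),
    mem_range_self _⟩, fun h => ?_⟩
  · rw [Function.update_of_ne hk.ne]
  · have := congrFun (codeCenter_injective h) n
    simp at this

/-! ### A code with a dense shift orbit. -/

/-- A binary code that contains every finite word. -/
def universalCode (j : ℕ) : Bool := (Nat.log2 j).testBit (j - 2 ^ Nat.log2 j)

/-- The block of positions from `2 ^ m` to `2 ^ (m + 1) - 1` spells the binary digits of `m`, lowest
first. So `m` is chosen with the wanted word as its lowest digits. -/
theorem exists_universalCode_eq (v : ℕ → Bool) (n : ℕ) :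
    ∃ N, ∀ k < n, universalCode (N + k) = v k := by
  -- The additional top digit `1` forces `2 ^ n ≤ m`, so that the block of length `2 ^ m` has room
  -- for the word.
  set m := Nat.ofBits fun i : Fin (n + 1) => if (i : ℕ) < n then v i else true with hm
  have hbit : ∀ i, i < n + 1 → m.testBit i = if i < n then v i else true := fun i hi => by
    rw [hm, Nat.testBit_ofBits_lt _ _ hi]
  have hmn : 2 ^ n ≤ m := Nat.ge_two_pow_of_testBit (by rw [hbit n n.lt_succ_self]; simp)
  refine ⟨2 ^ m, fun k hk => ?_⟩
  have hkm : k < 2 ^ m := (hk.trans (Nat.lt_two_pow_self)).trans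
    (hmn.trans_lt Nat.lt_two_pow_self)
  have hlog : Nat.log2 (2 ^ m + k) = m := by
    rw [Nat.log2_eq_iff (by positivity)]
    exact ⟨Nat.le_add_right _ _, by rw [pow_succ]; omega⟩
  rw [universalCode, hlog, Nat.add_sub_cancel_left, hbit k (by omega), if_pos hk]

theorem mainTheorem9 :
    ∃ (k : ℝ → ℝ) (c : ℕ → ℝ),
      IsC1Lip k ∧
      IsInfinitelyQuintRenormalizable k ∧
      (∀ n, IsUnimodal (quintRenorm^[n] k) (c n)) ∧
      HasQuadraticTip k (c 0) ∧
      ∃ C : Set ℝ, IsCantorSet C ∧ (∀ n, c n ∈ C) ∧ C ⊆ closure (range c) := by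
  have hp := admissible_codeParam universalCode
  have hc : ∀ n, tipCenter (shiftSeq^[n] (codeParam universalCode)) =
      codeCenter fun k => universalCode (n + k) := fun n => by
    rw [iterate_shift_codeParam, codeCenter]
  refine ⟨tipMap (codeParam universalCode),
    fun n => tipCenter (shiftSeq^[n] (codeParam universalCode)), isC1Lip_tipMap hp,
    isInfinitelyQuintRenormalizable_tip hp,
    fun n => isUnimodal_of_eqOn_tipMap (hp.iterate_shift n) (iterate_quintRenorm_tip hp n),
    hasQuadraticTip_tip hp, range codeCenter, isCantorSet_range_codeCenter,
    fun n => ⟨_, (hc n).symm⟩, ?_⟩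
  rintro _ ⟨v, rfl⟩
  rw [mem_closure_iff_nhds]
  intro U hU
  obtain ⟨n, hn⟩ := exists_pow_lt_of_mem_nhds hU
  obtain ⟨N, hN⟩ := exists_universalCode_eq v n
  refine ⟨_, hn _ ?_, mem_range_self N⟩
  rw [hc N]
  exact abs_codeCenter_sub_le n hN
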